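/- A derangement of length $n$ is a permutation of $n$ elements without fixed points. Let $D(n)$ be the number of derangements of length $n$, and let $d(n,k)$ be the number of those that have exactly $k$ cycles. Let $q$ and $r$ be integers with $0\le r<q$, and write $m=\lfloor n/2\rfloor$. Then \[ \lim_{n\to\infty}\frac{\sum_{j=0}^{\lfloor m/q\rfloor} d(n,r+jq)}{D(n)} =\lim_{n\to\infty}\frac{d(n,r)+d(n,q+r)+\cdots+d(n,q\lfloor (m-r)/q\rfloor+r)}{D(n)}=\frac1q . \] In other words, if $k$ is the number of cycles of a uniformly random derangement of length $n$, then the probability that $k\equiv r \pmod q$ tends to $1/q$ as $n\to\infty$. -/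

import Mathlib

open Filter Topology

/-- The number of cycles of a permutation of `{0, …, n - 1}`; every fixed point counts as a cycle
of length `1`. -/
def cycleCount {n : ℕ} (σ : Equiv.Perm (Fin n)) : ℕ :=
  Multiset.card σ.partition.parts

/-- `D(n)`: the number of derangements of length `n`. -/
noncomputable def derangementNumber (n : ℕ) : ℕ :=
  (derangements (Fin n)).ncard

/-- `d(n, k)`: the number of derangements of length `n` with exactly `k` cycles. -/
noncomputable def derangementCycleNumber (n k : ℕ) : ℕ :=
  {σ ∈ derangements (Fin n) | cycleCount σ = k}.ncard

/-- The law of a uniformly random derangement of length `n`, as a measure on the permutations of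
`{0, …, n - 1}` with the discrete sigma-algebra. It is a probability measure unless `n = 1`, the
one length without derangements. -/
noncomputable def uniformDerangement (n : ℕ) :
    @MeasureTheory.Measure (Equiv.Perm (Fin n)) ⊤ :=
  @ProbabilityTheory.uniformOn (Equiv.Perm (Fin n)) ⊤ (derangements (Fin n))

/-!
Let `D_n(x)` be the sum of `x ^ (number of cycles of σ)` over the derangements `σ` of `n` points, so
that `D_n(1)` is the number of derangements. By the roots of unity filter, the number of derangements
whose number of cycles is congruent to `r` modulo `q` is the average of `ω⁻ʳ D_n(ω)` over the `q`-th
roots of unity `ω` (`mul_derangementResidueNumber`). The root `ω = 1` contributes `D_n(1) / q`, and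
it remains to see that `D_n(ω) / D_n(1)` tends to zero for `ω ≠ 1` on the unit circle.

Since `D_n(1) / n!` tends to `1 / e ≠ 0`, this says that `a_n = D_n(ω) / n!` tends to zero. Removing
one point from its cycle gives the recurrence `D_{n+2}(x) = (n+1) (D_{n+1}(x) + x D_n(x))`
(`derangementSum_fin_add_two`), that is, `(n+2) a_{n+2} = (n+1) a_{n+1} + ω a_n`. Hence `a` is bounded
by `1`, its consecutive differences are `O(1/n)`, and replacing `a_n` by `a_{n+1}` in the recurrence
costs only `O(1/n²)`: up to this error `a_{n+2}` is `(n + 1 + ω) / (n + 2) * a_{n+1}`, whose factor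
has modulus at most `1 - (2 - ‖1 + ω‖) / (n + 2)`. As `‖1 + ω‖ < 2` and the harmonic series diverges,
`a` tends to zero (`tendsto_zero_of_recurrence`).

A derangement of length `n` has at most `n / 2` cycles, so both finite sums in the statement count
exactly the derangements whose number of cycles is congruent to `r`.
-/

/-! ### Cycles of permutations and the recurrence of the derangement polynomials -/

section Combinatorics

variable {α β : Type*} [Fintype α] [DecidableEq α] [Fintype β] [DecidableEq β]

theorem cycleType_permCongr (e : α ≃ β) (σ : Equiv.Perm α) :
    (e.permCongr σ).cycleType = σ.cycleType := by
  have h : e.permCongr σ =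
      σ.extendDomain (p := fun _ : β => True) (e.trans (Equiv.subtypeUnivEquiv (by simp)).symm) := by
    ext x
    rw [Equiv.Perm.extendDomain_apply_subtype _ _ trivial]
    simp [Equiv.subtypeUnivEquiv]
  rw [h, Equiv.Perm.cycleType_extendDomain]

theorem cycleType_optionCongr (σ : Equiv.Perm α) :
    Equiv.Perm.cycleType (Equiv.optionCongr σ) = σ.cycleType := by
  have h : Equiv.optionCongr σ = σ.extendDomain (Equiv.optionIsSomeEquiv α).symm := by
    ext1 x
    cases x with
    | none => rw [Equiv.Perm.extendDomain_apply_not_subtype _ _ (by simp)]; simp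
    | some a => rw [Equiv.Perm.extendDomain_apply_subtype _ _ (by simp)]; simp
  rw [h, Equiv.Perm.cycleType_extendDomain]

/-- Inserting a fixed point `b` into the cycle through a moved point `a` does not change the number
of nontrivial cycles. -/
theorem card_cycleType_swap_mul {σ : Equiv.Perm α} {a b : α} (ha : σ a ≠ a) (hb : σ b = b) :
    Multiset.card (Equiv.swap b a * σ).cycleType = Multiset.card σ.cycleType := by
  have ha' : a ∈ σ.support := Equiv.Perm.mem_support.2 ha
  set c := σ.cycleOf a with hc
  have hcyc : c.IsCycle := Equiv.Perm.isCycle_cycleOf σ ha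
  have hcb : b ∉ σ.toList a := by
    rw [Equiv.Perm.mem_toList_iff]
    rintro ⟨h, -⟩
    exact ha ((h.apply_eq_self_iff).2 hb)
  -- the list `b :: toList σ a` traverses the enlarged cycle
  have hform : Equiv.swap b a * c = (b :: σ.toList a).formPerm := by
    have h0 := Equiv.Perm.toList_getElem_zero σ a ha'
    have hlen := Equiv.Perm.length_toList_pos_of_mem_support σ a ha'
    rw [hc, ← Equiv.Perm.formPerm_toList]
    match hl : σ.toList a with
    | [] => simp [hl] at hlen
    | x :: l =>
      simp only [hl, List.getElem_cons_zero] at h0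
      subst h0
      rw [List.formPerm_cons_cons]
  have hcyc' : (Equiv.swap b a * c).IsCycle := by
    rw [hform]
    refine List.isCycle_formPerm (List.nodup_cons.2 ⟨hcb, Equiv.Perm.nodup_toList σ a⟩) ?_
    have := Equiv.Perm.length_toList_pos_of_mem_support σ a ha'
    simp only [List.length_cons]
    omega
  have hdis : (σ * c⁻¹).Disjoint c := Equiv.Perm.disjoint_mul_inv_of_mem_cycleFactorsFinset
    (Equiv.Perm.cycleOf_mem_cycleFactorsFinset_iff.2 ha')
  set ρ := σ * c⁻¹ with hρ
  have hσ : σ = c * ρ := by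
    rw [← hdis.commute.eq, hρ]; simp
  have hdis' : (Equiv.swap b a * c).Disjoint ρ := by
    intro x
    by_cases hx : x ∈ b :: σ.toList a
    · right
      rcases List.mem_cons.1 hx with rfl | hx
      · have hcx : c x = x := by
          rw [hc, ← Equiv.Perm.formPerm_toList]
          exact List.formPerm_apply_of_notMem hcb
        have : c⁻¹ x = x := by rw [Equiv.Perm.inv_eq_iff_eq, hcx]
        rw [hρ, Equiv.Perm.mul_apply, this, hb]
      · refine (hdis x).resolve_right ?_
        rw [hc, ← Equiv.Perm.formPerm_toList]
        exact (List.formPerm_apply_mem_ne_self_iff _ (Equiv.Perm.nodup_toList σ a) x hx).2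
          ((Equiv.Perm.two_le_length_toList_iff_mem_support).2 ha')
    · left
      rw [hform]
      exact List.formPerm_apply_of_notMem hx
  have e1 : (Equiv.swap b a * σ).cycleType = (Equiv.swap b a * c).cycleType + ρ.cycleType := by
    rw [← hdis'.cycleType_mul, mul_assoc, ← hσ]
  have e2 : σ.cycleType = c.cycleType + ρ.cycleType := by
    rw [← hdis.symm.cycleType_mul, ← hσ]
  rw [e1, e2, hcyc'.cycleType, hcyc.cycleType]
  simp

/-- The derangement polynomial `∑ x ^ (number of cycles of σ)`, summed over the derangements `σ`
of `α`. As a derangement has no fixed points, all of its cycles are counted by `cycleType`. -/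
def derangementSum (α : Type*) [Fintype α] [DecidableEq α] (x : ℂ) : ℂ :=
  ∑ σ : Equiv.Perm α with ∀ a, σ a ≠ a, x ^ Multiset.card σ.cycleType

theorem derangementSum_congr (e : α ≃ β) (x : ℂ) : derangementSum α x = derangementSum β x := by
  refine Finset.sum_equiv e.permCongr (fun σ => ?_) (fun σ _ => ?_)
  · simp only [Finset.mem_filter, Finset.mem_univ, true_and, Equiv.permCongr_apply]
    rw [e.forall_congr_left]
    simp [Equiv.eq_symm_apply]
  · rw [cycleType_permCongr]

/-- Permutations whose only fixed point is `a` correspond to derangements of the other points. -/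
theorem sum_fixing_only (a : α) (x : ℂ) :
    ∑ σ : Equiv.Perm α with ∀ b, σ b = b ↔ b = a, x ^ Multiset.card σ.cycleType =
      derangementSum {b // b ≠ a} x := by
  symm
  refine Finset.sum_nbij Equiv.Perm.ofSubtype ?_
    Equiv.Perm.ofSubtype_injective.injOn ?_ ?_
  · intro τ hτ
    simp only [Finset.mem_filter, Finset.mem_univ, true_and] at hτ ⊢
    intro b
    by_cases hb : b = a
    · simp [hb, Equiv.Perm.ofSubtype_apply_of_not_mem]
    · rw [Equiv.Perm.ofSubtype_apply_of_mem τ hb]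
      simp only [hb, iff_false]
      exact fun h => hτ ⟨b, hb⟩ (Subtype.ext h)
  · intro σ hσ
    simp only [Finset.coe_filter, Finset.mem_univ, true_and, Set.mem_ofPred_eq] at hσ
    have hσa : σ a = a := (hσ a).2 rfl
    have hp : ∀ b, σ b ≠ a ↔ b ≠ a := fun b => by
      rw [not_iff_not]
      conv_lhs => rw [← hσa]
      exact σ.injective.eq_iff
    refine ⟨σ.subtypePerm hp, ?_, Equiv.Perm.ofSubtype_subtypePerm hp ?_⟩
    · simp only [Finset.coe_filter, Finset.mem_univ, true_and, Set.mem_ofPred_eq]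
      rintro ⟨b, hb⟩ h
      exact hb ((hσ b).1 (congrArg Subtype.val h))
    · rintro b h rfl
      exact h hσa
  · intro τ _
    rw [Equiv.Perm.cycleType_ofSubtype]

/-- The contribution of the derangements of `Option α` with `none ↦ some a`. Removing `none` from its
cycle leaves a permutation `σ` of `α` with no fixed point but possibly `a`: if `a` is moved, the
number of cycles is unchanged; if it is fixed, the 2-cycle of `none` and `a` has been lost. -/
theorem sum_swap_mul_optionCongr (a : α) (x : ℂ) :
    (∑ σ : Equiv.Perm α, if ∀ o, (Equiv.swap none (some a) * Equiv.optionCongr σ) o ≠ o then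
        x ^ Multiset.card (Equiv.swap none (some a) * Equiv.optionCongr σ).cycleType else 0) =
      derangementSum α x + x * derangementSum {b // b ≠ a} x := by
  rw [← sum_fixing_only, derangementSum, Finset.sum_filter, Finset.sum_filter, Finset.mul_sum,
    ← Finset.sum_add_distrib]
  refine Finset.sum_congr rfl fun σ _ => ?_
  have key : (∀ o, (Equiv.swap none (some a) * Equiv.optionCongr σ) o ≠ o) ↔
      ∀ b, σ b = b → b = a := by
    have h1 (b : α) : (Equiv.swap none (some a) * Equiv.optionCongr σ) (some b) = some b ↔
        σ b = b ∧ b ≠ a := by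
      simp only [Equiv.Perm.mul_apply, Equiv.optionCongr_apply, Option.map_some]
      rw [← Equiv.eq_symm_apply, Equiv.symm_swap]
      by_cases hb : b = a
      · simp [hb]
      · rw [Equiv.swap_apply_of_ne_of_ne (by simp) (by simpa using hb)]
        simp [hb]
    have h2 : (Equiv.swap none (some a) * Equiv.optionCongr σ) none ≠ none := by simp
    rw [Option.forall]
    simp only [ne_eq, h1, h2, not_false_eq_true, true_and, not_and, not_not]
  simp only [key]
  by_cases hder : ∀ b, σ b ≠ b
  · have h3 : ¬ ∀ b, σ b = b ↔ b = a := fun h => hder a ((h a).2 rfl)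
    rw [if_pos hder, if_neg h3, if_pos fun b hb => absurd hb (hder b),
      card_cycleType_swap_mul (by simpa using hder a) (by simp), cycleType_optionCongr]
    simp
  · rw [if_neg hder]
    by_cases h4 : ∀ b, σ b = b → b = a
    · have ha : σ a = a := by
        push Not at hder
        obtain ⟨b, hb⟩ := hder
        rwa [h4 b hb] at hb
      rw [if_pos h4, if_pos fun b => ⟨h4 b, fun h => h ▸ ha⟩]
      have hdis : (Equiv.swap none (some a)).Disjoint (Equiv.optionCongr σ) := by
        rintro (_ | b)
        · right; simp
        · by_cases hb : b = a
          · right; simp [hb, ha]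
          · left; exact Equiv.swap_apply_of_ne_of_ne (by simp) (by simpa using hb)
      rw [hdis.cycleType_mul, cycleType_optionCongr, Multiset.card_add,
        Equiv.Perm.card_cycleType_eq_one.2 (Equiv.Perm.isCycle_swap (by simp)), pow_add]
      simp
    · rw [if_neg h4, if_neg fun h => h4 fun b => (h b).1]
      simp

theorem derangementSum_option (x : ℂ) :
    derangementSum (Option α) x =
      ∑ a : α, (derangementSum α x + x * derangementSum {b // b ≠ a} x) := by
  rw [derangementSum, Finset.sum_filter, ← Equiv.Perm.decomposeOption.symm.sum_comp,
    Fintype.sum_prod_type, Fintype.sum_option]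
  simp only [Equiv.Perm.decomposeOption_symm_apply]
  rw [Finset.sum_eq_zero fun σ _ => if_neg fun h => h none (by simp), zero_add]
  exact Finset.sum_congr rfl fun a _ => sum_swap_mul_optionCongr a x

/-- The recurrence `D_{n+2}(x) = (n+1) (D_{n+1}(x) + x D_n(x))` of the derangement polynomials. -/
theorem derangementSum_fin_add_two (n : ℕ) (x : ℂ) :
    derangementSum (Fin (n + 2)) x =
      (n + 1) * (derangementSum (Fin (n + 1)) x + x * derangementSum (Fin n) x) := by
  rw [derangementSum_congr (finSuccEquiv (n + 1)), derangementSum_option]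
  have h (a : Fin (n + 1)) : derangementSum {b // b ≠ a} x = derangementSum (Fin n) x :=
    derangementSum_congr (Fintype.equivOfCardEq (by simp [Fintype.card_subtype_compl])) x
  simp [h, mul_add]

theorem derangementSum_fin_zero (x : ℂ) : derangementSum (Fin 0) x = 1 := by
  simp [derangementSum, Finset.univ_unique, Subsingleton.elim _ (1 : Equiv.Perm (Fin 0))]

theorem derangementSum_fin_one (x : ℂ) : derangementSum (Fin 1) x = 0 := by
  refine Finset.sum_eq_zero fun σ hσ => ?_
  simp [Subsingleton.elim σ 1] at hσ

end Combinatorics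

/-! ### Asymptotics of the derangement polynomials on the unit circle -/

section Analysis

/-- A nonnegative sequence that loses a proportion `δ / (n + 2)` at each step, up to a summable
error, tends to zero because the harmonic series diverges. -/
theorem tendsto_zero_of_harmonic_decay {w : ℕ → ℝ} {δ : ℝ} (hδ : 0 < δ) (hw : ∀ n, 0 ≤ w n)
    (h : ∀ n : ℕ, w (n + 1) ≤ w n - δ * w n / (n + 2) + 2 / ((n + 1) * (n + 2))) :
    Tendsto w atTop (𝓝 0) := by
  -- adding `2 / (n + 1)` absorbs the error term by telescoping
  set v : ℕ → ℝ := fun n => w n + 2 / (n + 1) with hv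
  have hstep (n : ℕ) : δ * w n / (n + 2) ≤ v n - v (n + 1) := by
    have e : (2 : ℝ) / (n + 1) - 2 / (n + 2) = 2 / ((n + 1) * (n + 2)) := by
      field_simp; ring
    have e' : ((n + 1 : ℕ) : ℝ) + 1 = n + 2 := by push_cast; ring
    simp only [hv, e']
    linarith [h n]
  have hterm (n : ℕ) : 0 ≤ δ * w n / (n + 2) := by have := hw n; positivity
  have hv0 (n : ℕ) : 0 ≤ v n := by have := hw n; simp only [hv]; positivity
  have hanti : Antitone v := antitone_nat_of_succ_le fun n => by linarith [hstep n, hterm n]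
  have hvL := tendsto_atTop_ciInf hanti ⟨0, by rintro _ ⟨n, rfl⟩; exact hv0 n⟩
  set L := ⨅ n, v n
  have hinv : Tendsto (fun n : ℕ => (2 : ℝ) / (n + 1)) atTop (𝓝 0) := by
    simpa [div_eq_mul_inv] using (tendsto_one_div_add_atTop_nhds_zero_nat (𝕜 := ℝ)).const_mul 2
  have hwL : Tendsto w atTop (𝓝 L) := by
    simpa [hv] using hvL.sub hinv
  have hL : 0 ≤ L := ge_of_tendsto' hwL hw
  rcases hL.eq_or_lt with hL | hL
  · rwa [← hL] at hwL
  exfalso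
  have hsum : Summable fun n : ℕ => δ * w n / (n + 2) := by
    refine summable_of_sum_range_le (c := v 0) hterm fun N => ?_
    calc ∑ n ∈ Finset.range N, δ * w n / (n + 2)
        ≤ ∑ n ∈ Finset.range N, (v n - v (n + 1)) := Finset.sum_le_sum fun n _ => hstep n
      _ = v 0 - v N := Finset.sum_range_sub' v N
      _ ≤ v 0 := by linarith [hv0 N]
  have hharm : Summable fun n : ℕ => δ * (L / 2) * (1 / ((n + 2 : ℕ) : ℝ)) := by
    refine hsum.of_norm_bounded_eventually_nat ?_
    filter_upwards [hwL.eventually (lt_mem_nhds (half_lt_self hL))] with n hn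
    rw [Real.norm_of_nonneg (by positivity)]
    push_cast
    rw [mul_one_div]
    gcongr
  rw [summable_mul_left_iff (by positivity),
    summable_nat_add_iff (f := fun n : ℕ => 1 / (n : ℝ)) 2] at hharm
  exact Real.not_summable_one_div_natCast hharm

theorem norm_one_add_lt_two {x : ℂ} (hx : ‖x‖ = 1) (hx1 : x ≠ 1) : ‖1 + x‖ < 2 := by
  have := norm_add_lt_of_not_sameRay (x := (1 : ℂ)) (y := x) fun h => hx1
    (h.eq_of_norm_eq (by simp [hx])).symm
  rw [norm_one, hx] at this
  linarith

/-- Solutions of the recurrence of the normalised derangement polynomials `D_n(x) / n!` tend to zero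
on the unit circle away from `x = 1`. The consecutive differences are `O(1 / n)`, so that, up to an
error `O(1 / n ^ 2)`, each step multiplies by `(n + 1 + x) / (n + 2)`, whose modulus is at most
`1 - (2 - ‖1 + x‖) / (n + 2)`. -/
theorem tendsto_zero_of_recurrence {a : ℕ → ℂ} {x : ℂ} (hx : ‖x‖ = 1) (hx1 : x ≠ 1)
    (h0 : a 0 = 1) (h1 : a 1 = 0)
    (h : ∀ n : ℕ, (n + 2) * a (n + 2) = (n + 1) * a (n + 1) + x * a n) :
    Tendsto a atTop (𝓝 0) := by
  have hnorm (n : ℕ) : ‖(n + 2 : ℂ)‖ = n + 2 := by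
    rw [show (n + 2 : ℂ) = ((n + 2 : ℕ) : ℂ) by push_cast; ring, Complex.norm_natCast]
    push_cast; ring
  have hnorm1 (n : ℕ) : ‖(n + 1 : ℂ)‖ = n + 1 := by
    rw [show (n + 1 : ℂ) = ((n + 1 : ℕ) : ℂ) by push_cast; ring, Complex.norm_natCast]
    push_cast; ring
  have hbound : ∀ n, ‖a n‖ ≤ 1 ∧ ‖a (n + 1)‖ ≤ 1 := by
    intro n
    induction n with
    | zero => simp [h0, h1]
    | succ n ih =>
      refine ⟨ih.2, ?_⟩
      have := congrArg norm (h n)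
      rw [norm_mul, hnorm] at this
      have h2 : ‖(n + 1 : ℂ) * a (n + 1) + x * a n‖ ≤ (n + 1) * 1 + 1 * 1 := by
        refine (norm_add_le _ _).trans ?_
        rw [norm_mul, norm_mul, hnorm1, hx]
        gcongr
        exacts [ih.2, ih.1]
      have h3 : (0 : ℝ) < n + 2 := by positivity
      refine le_of_mul_le_mul_left ?_ h3
      change (n + 2 : ℝ) * ‖a (n + 2)‖ ≤ _
      linarith
  have hdiff (n : ℕ) : ‖a (n + 1) - a n‖ ≤ 2 / (n + 1) := by
    cases n with
    | zero => simp [h0, h1]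
    | succ n =>
      have e : (n + 2 : ℂ) * (a (n + 2) - a (n + 1)) = x * a n - a (n + 1) := by
        linear_combination h n
      have h2 : ‖x * a n - a (n + 1)‖ ≤ 1 * 1 + 1 := by
        refine (norm_sub_le _ _).trans ?_
        rw [norm_mul, hx]
        gcongr
        exacts [(hbound n).1, (hbound n).2]
      rw [← e, norm_mul, hnorm] at h2
      rw [le_div_iff₀ (by positivity)]
      push_cast
      change ‖a (n + 2) - a (n + 1)‖ * _ ≤ _
      linarith
  have hstep (n : ℕ) : ‖a (n + 2)‖ ≤ ‖a (n + 1)‖ - (2 - ‖1 + x‖) * ‖a (n + 1)‖ / (n + 2) +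
      2 / ((n + 1) * (n + 2)) := by
    have e : (n + 2 : ℂ) * a (n + 2) =
        (n + (1 + x)) * a (n + 1) - x * (a (n + 1) - a n) := by
      linear_combination h n
    have h2 : (n + 2) * ‖a (n + 2)‖ ≤ (n + ‖1 + x‖) * ‖a (n + 1)‖ + 2 / (n + 1) := by
      rw [← hnorm, ← norm_mul, e]
      refine (norm_sub_le _ _).trans ?_
      rw [norm_mul, norm_mul, hx, one_mul]
      gcongr
      · exact (norm_add_le _ _).trans (by simp)
      · exact hdiff n
    have h3 : (0 : ℝ) < n + 2 := by positivity
    refine le_of_mul_le_mul_left (h2.trans_eq ?_) h3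
    field_simp
    ring
  rw [← tendsto_add_atTop_iff_nat 1, tendsto_zero_iff_norm_tendsto_zero]
  exact tendsto_zero_of_harmonic_decay (by linarith [norm_one_add_lt_two hx hx1])
    (fun n => norm_nonneg _) hstep

theorem tendsto_derangementSum_div_factorial {x : ℂ} (hx : ‖x‖ = 1) (hx1 : x ≠ 1) :
    Tendsto (fun n : ℕ => derangementSum (Fin n) x / n.factorial) atTop (𝓝 0) := by
  refine tendsto_zero_of_recurrence hx hx1 (by simp [derangementSum_fin_zero])
    (by simp [derangementSum_fin_one]) fun n => ?_
  have hf : (n.factorial : ℂ) ≠ 0 := Nat.cast_ne_zero.2 n.factorial_ne_zero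
  have h1 : (n + 1 : ℂ) ≠ 0 := Nat.cast_add_one_ne_zero n
  have h2 : (n + 2 : ℂ) ≠ 0 := by exact_mod_cast (n + 1).succ_ne_zero
  have h2' : (n + 1 + 1 : ℂ) ≠ 0 := by rw [add_assoc, one_add_one_eq_two]; exact h2
  rw [derangementSum_fin_add_two, Nat.factorial_succ (n + 1), Nat.factorial_succ n]
  push_cast
  field_simp
  ring

theorem tendsto_derangementSum_div_numDerangements {x : ℂ} (hx : ‖x‖ = 1) (hx1 : x ≠ 1) :
    Tendsto (fun n : ℕ => derangementSum (Fin n) x / numDerangements n) atTop (𝓝 0) := by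
  have hlim := (Complex.continuous_ofReal.tendsto _).comp numDerangements_tendsto_inv_e
  have := (tendsto_derangementSum_div_factorial hx hx1).div hlim (by
    rw [Complex.ofReal_ne_zero]; exact (Real.exp_pos _).ne')
  rw [zero_div] at this
  refine this.congr fun n => ?_
  have hf : (n.factorial : ℂ) ≠ 0 := Nat.cast_ne_zero.2 n.factorial_ne_zero
  simp only [Pi.div_apply, Function.comp_apply]
  push_cast
  rw [div_div_div_cancel_right₀ hf]

end Analysis

/-! ### Counting cycles modulo `q` with roots of unity -/

section RootsOfUnity

variable {n : ℕ}

theorem cycleCount_eq_card_cycleType {σ : Equiv.Perm (Fin n)} (hσ : σ ∈ derangements (Fin n)) :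
    cycleCount σ = Multiset.card σ.cycleType := by
  have h : σ.support = Finset.univ := by ext a; simpa using hσ a
  simp [cycleCount, Equiv.Perm.parts_partition, h]

theorem cycleCount_le_half {σ : Equiv.Perm (Fin n)} (hσ : σ ∈ derangements (Fin n)) :
    cycleCount σ ≤ n / 2 := by
  rw [cycleCount_eq_card_cycleType hσ, Nat.le_div_iff_mul_le two_pos, ← smul_eq_mul]
  calc Multiset.card σ.cycleType • 2 ≤ σ.cycleType.sum :=
        Multiset.card_nsmul_le_sum fun _ => Equiv.Perm.two_le_of_mem_cycleType
    _ ≤ n := by simpa using σ.sum_cycleType_le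

theorem derangementNumber_eq_numDerangements (n : ℕ) :
    derangementNumber n = numDerangements n := by
  rw [derangementNumber, ← Nat.card_coe_set_eq, Nat.card_eq_fintype_card,
    card_derangements_fin_eq_numDerangements]

/-- The number of derangements of length `n` whose number of cycles is congruent to `r`
modulo `q`. -/
noncomputable def derangementResidueNumber (n q r : ℕ) : ℕ :=
  {σ ∈ derangements (Fin n) | cycleCount σ ≡ r [MOD q]}.ncard

theorem sum_pow_div_pow_eq_ite {q : ℕ} {ζ : ℂ} (hζ : IsPrimitiveRoot ζ q) (hq : q ≠ 0) (c r : ℕ) :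
    ∑ j ∈ Finset.range q, (ζ ^ j) ^ c / (ζ ^ j) ^ r = if c ≡ r [MOD q] then (q : ℂ) else 0 := by
  have h0 : ζ ≠ 0 := hζ.ne_zero hq
  have h1 (j : ℕ) : (ζ ^ j) ^ c / (ζ ^ j) ^ r = (ζ ^ c / ζ ^ r) ^ j := by
    rw [div_pow, ← pow_mul, ← pow_mul, ← pow_mul, ← pow_mul, mul_comm j, mul_comm j]
  have h2 : ζ ^ c / ζ ^ r = 1 ↔ c ≡ r [MOD q] := by
    have := pow_eq_pow_iff_modEq (x := Units.mk0 ζ h0) (m := r) (n := c)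
    rwa [← orderOf_units, Units.val_mk0, ← hζ.eq_orderOf, Units.ext_iff, Units.val_pow_eq_pow_val,
      Units.val_pow_eq_pow_val, Units.val_mk0, ← div_eq_one_iff_eq (pow_ne_zero _ h0)] at this
  simp only [h1]
  split_ifs with h
  · simp [h2.2 h]
  · rw [geom_sum_eq (mt h2.1 h), div_pow, ← pow_mul, ← pow_mul, mul_comm c, mul_comm r, pow_mul,
      pow_mul, hζ.pow_eq_one]
    simp

/-- The roots of unity filter applied to the derangement polynomials. -/
theorem mul_derangementResidueNumber {q : ℕ} {ζ : ℂ} (hζ : IsPrimitiveRoot ζ q) (hq : q ≠ 0)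
    (n r : ℕ) :
    (q : ℂ) * derangementResidueNumber n q r =
      ∑ j ∈ Finset.range q, derangementSum (Fin n) (ζ ^ j) / (ζ ^ j) ^ r := by
  classical
  have hset : {σ ∈ derangements (Fin n) | cycleCount σ ≡ r [MOD q]} =
      ((Finset.univ.filter fun σ : Equiv.Perm (Fin n) => ∀ a, σ a ≠ a).filter
        fun σ => Multiset.card σ.cycleType ≡ r [MOD q] : Finset (Equiv.Perm (Fin n))) := by
    ext σ
    simp only [Finset.coe_filter, Finset.mem_filter, Finset.mem_univ, true_and]
    exact and_congr_right fun hσ => by rw [cycleCount_eq_card_cycleType hσ]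
  rw [derangementResidueNumber, hset, Set.ncard_coe_finset, Finset.card_filter]
  simp only [derangementSum, Finset.sum_div]
  rw [Finset.sum_comm]
  simp only [sum_pow_div_pow_eq_ite hζ hq]
  push_cast
  rw [Finset.mul_sum]
  refine Finset.sum_congr (by congr) fun σ _ => ?_
  split_ifs <;> simp

theorem derangementSum_one (n : ℕ) : derangementSum (Fin n) 1 = numDerangements n := by
  rw [← card_derangements_fin_eq_numDerangements, Fintype.card_subtype]
  simp [derangementSum, derangements]
  congr

theorem eventually_numDerangements_pos : ∀ᶠ n in atTop, 0 < numDerangements n := by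
  filter_upwards [numDerangements_tendsto_inv_e.eventually (lt_mem_nhds (Real.exp_pos _))] with n hn
  refine Nat.pos_of_ne_zero fun h => ?_
  simp [h] at hn

/-- Only the term `ζ ^ 0 = 1` of the roots of unity filter survives in the limit. -/
theorem tendsto_derangementResidueNumber_div {q : ℕ} (hq : q ≠ 0) (r : ℕ) :
    Tendsto (fun n : ℕ => (derangementResidueNumber n q r : ℝ) / derangementNumber n)
      atTop (𝓝 (1 / (q : ℝ))) := by
  have hζ := Complex.isPrimitiveRoot_exp q hq
  set ζ := Complex.exp (2 * Real.pi * Complex.I / q)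
  have hqC : (q : ℂ) ≠ 0 := Nat.cast_ne_zero.2 hq
  have hterm : ∀ j ∈ Finset.range q, Tendsto (fun n : ℕ =>
      derangementSum (Fin n) (ζ ^ j) / numDerangements n / (ζ ^ j) ^ r) atTop
      (𝓝 (if j = 0 then 1 else 0)) := by
    intro j hj
    split_ifs with h
    · subst h
      refine tendsto_const_nhds.congr' ?_
      filter_upwards [eventually_numDerangements_pos] with n hn
      have : (numDerangements n : ℂ) ≠ 0 := Nat.cast_ne_zero.2 hn.ne'
      simp [derangementSum_one, this]
    · have hnorm : ‖ζ ^ j‖ = 1 := by rw [norm_pow, hζ.norm'_eq_one hq, one_pow]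
      simpa using (tendsto_derangementSum_div_numDerangements hnorm
        (hζ.pow_ne_one_of_pos_of_lt h (Finset.mem_range.1 hj))).div_const ((ζ ^ j) ^ r)
  have hlim := (tendsto_finsetSum _ hterm).div_const (q : ℂ)
  rw [Finset.sum_ite_eq' _ _, if_pos (Finset.mem_range.2 (Nat.pos_of_ne_zero hq))] at hlim
  rw [← Filter.tendsto_ofReal_iff]
  push_cast
  refine hlim.congr fun n => ?_
  rw [derangementNumber_eq_numDerangements,
    show (derangementResidueNumber n q r : ℂ) = _ from
      eq_div_of_mul_eq hqC ((mul_comm _ _).trans (mul_derangementResidueNumber hζ hq n r)),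
    Finset.sum_div, Finset.sum_div, Finset.sum_div]
  exact Finset.sum_congr rfl fun j _ => by ring

end RootsOfUnity

/-! ### The probability and the finite sums -/

theorem uniformDerangement_toReal (n q r : ℕ) :
    (uniformDerangement n {σ | cycleCount σ ≡ r [MOD q]}).toReal =
      (derangementResidueNumber n q r : ℝ) / derangementNumber n := by
  let _ : MeasurableSpace (Equiv.Perm (Fin n)) := ⊤
  have hcount (s : Set (Equiv.Perm (Fin n))) :
      (MeasureTheory.Measure.count s).toReal = s.ncard := by
    rw [MeasureTheory.Measure.count_apply MeasurableSpace.measurableSet_top,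
      ← s.toFinite.cast_ncard_eq, ENat.toENNReal_coe, ENNReal.toReal_natCast]
  rw [uniformDerangement, ProbabilityTheory.uniformOn,
    ProbabilityTheory.cond_apply MeasurableSpace.measurableSet_top,
    ENNReal.toReal_mul, ENNReal.toReal_inv, hcount, hcount, mul_comm, ← div_eq_mul_inv]
  rfl

/-- A cycle number congruent to `r` has the form `r + j * q` with `j` its quotient by `q`, so the
sum reaches all of them once `N` bounds the quotients of the admissible cycle numbers. -/
theorem sum_derangementCycleNumber {n q r N : ℕ} (hr : r < q)
    (hN : ∀ k ≤ n / 2, k % q = r → k / q ≤ N) :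
    ∑ j ∈ Finset.range (N + 1), derangementCycleNumber n (r + j * q) =
      derangementResidueNumber n q r := by
  classical
  rw [derangementResidueNumber, Set.ncard_eq_toFinset_card',
    Finset.card_eq_sum_card_fiberwise (f := fun σ => cycleCount σ / q)
      (t := Finset.range (N + 1))]
  · refine Finset.sum_congr rfl fun j _ => ?_
    rw [derangementCycleNumber, Set.ncard_eq_toFinset_card']
    congr 1
    ext σ
    simp only [Set.mem_toFinset, Finset.mem_filter]
    change _ ∧ _ ↔ (_ ∧ _) ∧ _
    rw [and_assoc]
    refine and_congr_right fun _ => ?_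
    rw [Nat.ModEq, Nat.mod_eq_of_lt hr]
    constructor
    · intro h
      rw [h, Nat.add_mul_mod_self_right, Nat.mod_eq_of_lt hr,
        Nat.add_mul_div_right _ _ (by omega), Nat.div_eq_of_lt hr]
      simp
    · rintro ⟨h1, h2⟩
      rw [← h1, ← h2, mul_comm, Nat.mod_add_div]
  · intro σ hσ
    simp only [Set.coe_toFinset] at hσ
    have h := hσ.2
    rw [Nat.ModEq, Nat.mod_eq_of_lt hr] at h
    exact Finset.mem_coe.2 (Finset.mem_range_succ_iff.2 (hN _ (cycleCount_le_half hσ.1) h))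

theorem theorem4 (q r : ℕ) (hr : r < q) :
    Tendsto (fun n : ℕ => (uniformDerangement n {σ | cycleCount σ ≡ r [MOD q]}).toReal)
      atTop (𝓝 (1 / (q : ℝ))) ∧
    Tendsto (fun n : ℕ =>
        (∑ j ∈ Finset.range (n / 2 / q + 1), (derangementCycleNumber n (r + j * q) : ℝ)) /
          (derangementNumber n : ℝ))
      atTop (𝓝 (1 / (q : ℝ))) ∧
    Tendsto (fun n : ℕ =>
        (∑ j ∈ Finset.range ((n / 2 - r) / q + 1), (derangementCycleNumber n (r + j * q) : ℝ)) /
          (derangementNumber n : ℝ))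
      atTop (𝓝 (1 / (q : ℝ))) := by
  have hlim := tendsto_derangementResidueNumber_div (q := q) (by omega) r
  refine ⟨by simpa only [uniformDerangement_toReal] using hlim, hlim.congr fun n => ?_,
    hlim.congr fun n => ?_⟩
  · rw [← Nat.cast_sum, sum_derangementCycleNumber hr fun k hk _ => Nat.div_le_div_right hk]
  · rw [← Nat.cast_sum, sum_derangementCycleNumber hr fun k hk hkr => ?_]
    rw [Nat.le_div_iff_mul_le (by omega)]
    have := Nat.div_add_mod' k q
    omega
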